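/- For a well quasi-order $(A,\le)$ let $\mathrm{Bad}(A)$ be the tree of nonempty finite sequences $(x_1,\dots,x_\ell)$ in $A$ with $x_i\not\le x_j$ for all $i<j$, and let $\mathrm{Inco}(A)$ be the tree of nonempty finite sequences of pairwise incomparable elements of $A$; in both trees the children of a node are its one-term extensions at the end that belong to the tree. In a well-founded tree $T$ put $r(s)=\sup\{r(t)+1 : t \text{ a child of } s\}$ for each node $s$ (so $r(s)=0$ at a leaf), and let the rank of $T$ be $\sup_{s\in T}(r(s)+1)$. The width $w(A)$ is the rank of $\mathrm{Inco}(A)$, and the maximal order type $o(A)$ is the rank of $\mathrm{Bad}(A)$. **Theorem.** Let $n>0$ and $m\ge 0$, let $\alpha_1,\dots,\alpha_n\ge\omega$ be ordinals, let $0<k_1,\dots,k_m<\omega$, and let $Z=\alpha_1\times\dots\times\alpha_n\times k_1\times\dots\times k_m$ be the cartesian product with the componentwise order. Then $w(Z)=o(Z)$ if and only if both of the following hold: 1. there is $i\in\{1,\dots,n\}$ such that $\alpha_i$ is infinite and additively indecomposable, i.e. $\beta+\gamma<\alpha_i$ for all $\beta,\gamma<\alpha_i$; 2. there are $j_1\ne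 j_2$ in $\{1,\dots,n\}$ such that all exponents in the Cantor normal forms of $\alpha_{j_1}$ and of $\alpha_{j_2}$ are infinite. (The index $i$ may equal $j_1$ or $j_2$.) Moreover, for each $j\in\{1,\dots,n\}$, all exponents in the Cantor normal form of $\alpha_j$ are infinite if and only if $\alpha_j$ is divisible by $\omega^\omega$, i.e. $\alpha_j=\omega^\omega\cdot\delta$ for some ordinal $\delta$. -/

import Mathlib

universe u

/-- The nonempty finite sequences `(x₁, …, xₗ)` over `A` such that `R xᵢ xⱼ` for all `i < j`. -/
def seqTree {A : Type u} (R : A → A → Prop) : Set (List A) :=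
  {s | s ≠ [] ∧ s.Pairwise R}

/-- For nodes of a tree `T` of finite sequences ordered by initial segment:
`t` is a child of `s` if `t` is `s` extended by one more term at the end. -/
def IsChild {A : Type u} (T : Set (List A)) (t s : T) : Prop :=
  ∃ y : A, t.1 = s.1 ++ [y]

/-- The rank of a well-founded tree `T` of finite sequences: the supremum of `r s + 1` over the
nodes `s`, where `r s` is the supremum of `r t + 1` over the children `t` of `s`. -/
noncomputable def treeRank {A : Type u} (T : Set (List A)) [IsWellFounded T (IsChild T)] :
    Ordinal.{u} :=
  ⨆ s : T, Order.succ (IsWellFounded.rank (IsChild T) s)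

/-- The tree of nonempty bad sequences: no earlier term is below a later one. -/
def badTree (A : Type u) [Preorder A] : Set (List A) :=
  seqTree fun x y => ¬ x ≤ y

/-- The tree of nonempty antichains, as sequences of pairwise incomparable elements. -/
def incoTree (A : Type u) [Preorder A] : Set (List A) :=
  seqTree fun x y => ¬ x ≤ y ∧ ¬ y ≤ x

theorem seqTree_isWellFounded {A : Type u} [Preorder A] [WellQuasiOrderedLE A]
    {R : A → A → Prop} (hR : ∀ x y, R x y → ¬ x ≤ y) :
    IsWellFounded (seqTree R) (IsChild (seqTree R)) := by
  refine ⟨wellFounded_iff_isEmpty_descending_chain.2 ⟨fun ⟨f, hf⟩ => ?_⟩⟩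
  choose y hy using hf
  have hmem : ∀ i k, y i ∈ (f (i + 1 + k)).1 := by
    intro i k
    induction k with
    | zero => rw [add_zero, hy i]; simp
    | succ k ih => rw [← add_assoc, hy]; exact List.mem_append_left _ ih
  obtain ⟨i, j, hij, hle⟩ := wellQuasiOrdered_le (α := A) y
  obtain ⟨k, rfl⟩ := Nat.exists_eq_add_of_le (Nat.succ_le_of_lt hij)
  have hp := (f (i.succ + k + 1)).2.2
  rw [hy, List.pairwise_append] at hp
  exact hR _ _ (hp.2.2 _ (hmem i k) _ (by simp)) hle

instance badTree_isWellFounded (A : Type u) [Preorder A] [WellQuasiOrderedLE A] :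
    IsWellFounded (badTree A) (IsChild (badTree A)) :=
  seqTree_isWellFounded fun _ _ h => h

instance incoTree_isWellFounded (A : Type u) [Preorder A] [WellQuasiOrderedLE A] :
    IsWellFounded (incoTree A) (IsChild (incoTree A)) :=
  seqTree_isWellFounded fun _ _ h => h.1

/-- The width of a well quasi-order. -/
noncomputable def width (A : Type u) [Preorder A] [WellQuasiOrderedLE A] : Ordinal.{u} :=
  treeRank (incoTree A)

/-- The maximal order type of a well quasi-order. -/
noncomputable def maxOrderType (A : Type u) [Preorder A] [WellQuasiOrderedLE A] : Ordinal.{u} :=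
  treeRank (badTree A)

/-- The product `α₁ × ⋯ × αₙ × k₁ × ⋯ × kₘ` of ordinals and natural numbers (finite ordinals),
with the componentwise order. -/
abbrev OrdinalProduct {n m : ℕ} (α : Fin n → Ordinal.{u}) (k : Fin m → ℕ) : Type u :=
  (∀ i, (α i).ToType) × (∀ j, Fin (k j))

/-- All exponents in the Cantor normal form of `α` (in base `ω`) are infinite. The list
`Ordinal.CNF ω α` consists of the pairs (exponent, nonzero coefficient). -/
def HasOnlyInfiniteExponents (α : Ordinal.{u}) : Prop :=
  ∀ p ∈ Ordinal.CNF Ordinal.omega0 α, Ordinal.omega0 ≤ p.1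

/-! Cut every factor along its Cantor normal form into consecutive intervals of type `ω ^ e`. The
product becomes a finite union of boxes `∏ ω ^ e i`. The natural sum, over these boxes, of `ω` to
the natural sum of the `e i` bounds both width and type (`leRank_box_nsum`), and bad sequences
attain it (`geRank_bad_box_nsum`). The question is whether antichains attain it too.

Inside one box, incomparability costs a factor `ω` in front of two sides (`geRank_box_opow`);
infinite exponents absorb it, since `1 + e = e`. An infinite indecomposable factor is not cut at
all, so points chosen later can be pushed up in that coordinate past the earlier ones, and the ranks
of the boxes add up (`geRank_box_nsum`).

Conversely, a nontrivial box with at most one infinite exponent has too small an antichain rank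
(`leRank_antichain_box`). If no infinite factor is indecomposable, one box lies entirely below
another; no antichain meets both, and a term of the sum is lost
(`exists_leRank_lt_of_not_isPrincipal`). -/

open Ordinal Order

/-! ### Natural sum of ordinals -/

/-- The natural (Hessenberg) sum of two ordinals. -/
noncomputable def nadd (a b : Ordinal.{u}) : Ordinal.{u} :=
  max (⨆ x : Set.Iio a, succ (nadd x.1 b)) (⨆ x : Set.Iio b, succ (nadd a x.1))
termination_by (a, b)
decreasing_by
  · exact Prod.Lex.left _ _ x.2
  · exact Prod.Lex.right _ x.2

theorem lt_nadd_iff {a b c : Ordinal.{u}} :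
    c < nadd a b ↔ (∃ a' < a, c ≤ nadd a' b) ∨ ∃ b' < b, c ≤ nadd a b' := by
  rw [nadd, lt_max_iff, Ordinal.lt_iSup_iff, Ordinal.lt_iSup_iff]
  simp

theorem nadd_le_iff {a b c : Ordinal.{u}} :
    nadd a b ≤ c ↔ (∀ a' < a, nadd a' b < c) ∧ ∀ b' < b, nadd a b' < c := by
  rw [← not_lt, lt_nadd_iff]
  push Not
  rfl

theorem nadd_lt_nadd_left {b c : Ordinal.{u}} (h : b < c) (a) : nadd a b < nadd a c :=
  lt_nadd_iff.2 (Or.inr ⟨b, h, le_rfl⟩)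

theorem nadd_lt_nadd_right {b c : Ordinal.{u}} (h : b < c) (a) : nadd b a < nadd c a :=
  lt_nadd_iff.2 (Or.inl ⟨b, h, le_rfl⟩)

theorem nadd_le_nadd {a b c d : Ordinal.{u}} (h : a ≤ b) (h' : c ≤ d) : nadd a c ≤ nadd b d := by
  have h₁ : StrictMono (nadd a) := fun _ _ h => nadd_lt_nadd_left h a
  have h₂ : StrictMono (nadd · d) := fun _ _ h => nadd_lt_nadd_right h d
  exact (h₁.monotone h').trans (h₂.monotone h)

theorem nadd_comm (a b : Ordinal.{u}) : nadd a b = nadd b a := by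
  rw [nadd, nadd, max_comm]
  congr 1 <;> refine iSup_congr fun x => ?_ <;> have := x.2 <;> rw [nadd_comm]
termination_by (a, b)

theorem nadd_zero (a : Ordinal.{u}) : nadd a 0 = a := by
  induction a using WellFoundedLT.induction with
  | _ a ih =>
    refine eq_of_forall_lt_iff fun c => ?_
    rw [lt_nadd_iff]
    constructor
    · rintro (⟨a', h, hc⟩ | ⟨b', h, -⟩)
      · exact (ih a' h ▸ hc).trans_lt h
      · exact absurd h not_lt_zero
    · exact fun h => Or.inl ⟨c, h, (ih c h).ge⟩

theorem zero_nadd (a : Ordinal.{u}) : nadd 0 a = a := by rw [nadd_comm, nadd_zero]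

theorem nadd_assoc (a b c : Ordinal.{u}) : nadd (nadd a b) c = nadd a (nadd b c) := by
  apply le_antisymm
  · refine nadd_le_iff.2 ⟨fun x hx => ?_, fun c' hc => ?_⟩
    · rcases lt_nadd_iff.1 hx with ⟨a', h, hx⟩ | ⟨b', h, hx⟩
      · exact (nadd_le_nadd hx le_rfl).trans_lt
          ((nadd_assoc a' b c).trans_lt (nadd_lt_nadd_right h _))
      · exact (nadd_le_nadd hx le_rfl).trans_lt
          ((nadd_assoc a b' c).trans_lt (nadd_lt_nadd_left (nadd_lt_nadd_right h _) _))
    · exact (nadd_assoc a b c').trans_lt (nadd_lt_nadd_left (nadd_lt_nadd_left hc _) _)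
  · refine nadd_le_iff.2 ⟨fun a' ha => ?_, fun x hx => ?_⟩
    · exact (nadd_assoc a' b c).symm.trans_lt (nadd_lt_nadd_right (nadd_lt_nadd_right ha _) _)
    · rcases lt_nadd_iff.1 hx with ⟨b', h, hx⟩ | ⟨c', h, hx⟩
      · exact (nadd_le_nadd le_rfl hx).trans_lt
          ((nadd_assoc a b' c).symm.trans_lt (nadd_lt_nadd_right (nadd_lt_nadd_left h _) _))
      · exact (nadd_le_nadd le_rfl hx).trans_lt
          ((nadd_assoc a b c').symm.trans_lt (nadd_lt_nadd_left h _))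
termination_by (a, b, c)

theorem add_le_nadd (a b : Ordinal.{u}) : a + b ≤ nadd a b := by
  induction b using WellFoundedLT.induction with
  | _ b ih =>
    rw [← not_lt]
    intro h
    rcases eq_or_ne b 0 with rfl | hb
    · rw [add_zero, nadd_zero] at h
      exact lt_irrefl _ h
    · obtain ⟨b', hb', h'⟩ := (Ordinal.lt_add_iff hb).1 h
      exact lt_irrefl _ ((nadd_lt_nadd_left hb' a).trans_le (h'.trans (ih b' hb')))

/-! ### Natural sums and powers of `ω` -/

section

variable {c : Ordinal.{u}} (hc : ∀ x < ω ^ c, ∀ y < ω ^ c, nadd x y < ω ^ c)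
include hc

/-- Below a power of `ω` that is closed under natural sums, the natural sum with a multiple of that
power is the ordinary sum. -/
theorem nadd_le_add_of_lt (q : Ordinal.{u}) {y : Ordinal.{u}} (hy : y < ω ^ c) :
    nadd (ω ^ c * q) y ≤ ω ^ c * q + y := by
  induction q using WellFoundedLT.induction generalizing y with
  | _ q ihq =>
    induction y using WellFoundedLT.induction with
    | _ y ihy =>
      refine nadd_le_iff.2 ⟨fun x hx => ?_, fun y' hy' => ?_⟩
      · have hq : x / ω ^ c < q := (Ordinal.lt_mul_iff_div_lt (opow_pos c omega0_pos).ne').1 hx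
        have hr : x % ω ^ c < ω ^ c := Ordinal.mod_lt _ (opow_pos c omega0_pos).ne'
        calc nadd x y ≤ nadd (nadd (ω ^ c * (x / ω ^ c)) (x % ω ^ c)) y := by
              refine nadd_le_nadd ?_ le_rfl
              conv_lhs => rw [← Ordinal.div_add_mod x (ω ^ c)]
              exact add_le_nadd _ _
          _ ≤ ω ^ c * (x / ω ^ c) + nadd (x % ω ^ c) y := by
              rw [nadd_assoc]
              exact ihq _ hq (hc _ hr _ hy)
          _ < ω ^ c * (x / ω ^ c) + ω ^ c := by
              gcongr
              exact hc _ hr _ hy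
          _ = ω ^ c * succ (x / ω ^ c) := (mul_succ _ _).symm
          _ ≤ ω ^ c * q := by
              gcongr
              exact succ_le_of_lt hq
          _ ≤ ω ^ c * q + y := le_self_add
      · refine (ihy y' hy' (hy'.trans hy)).trans_lt ?_
        gcongr

theorem nadd_opow_eq (q : Ordinal.{u}) : nadd (ω ^ c * q) (ω ^ c) = ω ^ c * (q + 1) := by
  rw [mul_add, mul_one]
  refine le_antisymm ?_ (add_le_nadd _ _)
  induction q using WellFoundedLT.induction with
  | _ q ihq =>
    refine nadd_le_iff.2 ⟨fun x hx => ?_, fun y hy => ?_⟩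
    · have hq : x / ω ^ c < q := (Ordinal.lt_mul_iff_div_lt (opow_pos c omega0_pos).ne').1 hx
      have hr : x % ω ^ c < ω ^ c := Ordinal.mod_lt _ (opow_pos c omega0_pos).ne'
      calc nadd x (ω ^ c) ≤ nadd (nadd (ω ^ c * (x / ω ^ c)) (x % ω ^ c)) (ω ^ c) := by
            refine nadd_le_nadd ?_ le_rfl
            conv_lhs => rw [← Ordinal.div_add_mod x (ω ^ c)]
            exact add_le_nadd _ _
        _ = nadd (nadd (ω ^ c * (x / ω ^ c)) (ω ^ c)) (x % ω ^ c) := by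
            rw [nadd_assoc, nadd_comm (x % ω ^ c), ← nadd_assoc]
        _ ≤ nadd (ω ^ c * q) (x % ω ^ c) := by
            refine nadd_le_nadd ((ihq _ hq).trans ?_) le_rfl
            rw [← mul_succ]
            gcongr
            exact succ_le_of_lt hq
        _ ≤ ω ^ c * q + x % ω ^ c := nadd_le_add_of_lt hc q hr
        _ < ω ^ c * q + ω ^ c := by gcongr
    · refine (nadd_le_add_of_lt hc q hy).trans_lt ?_
      gcongr

end

/-- Both terms lie below finite multiples of one smaller power `ω ^ d`. Closure at `d`, known by
induction, lets these multiples be added like natural numbers. This discharges the hypothesis `hc`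
of the preceding section. -/
theorem nadd_lt_omega0_opow (c : Ordinal.{u}) :
    ∀ x < ω ^ c, ∀ y < ω ^ c, nadd x y < ω ^ c := by
  induction c using WellFoundedLT.induction with
  | _ c ih =>
    intro x hx y hy
    rcases eq_or_ne c 0 with rfl | hc
    · rw [opow_zero, Order.lt_one_iff] at *
      rw [hx, hy, nadd_zero]
    · obtain ⟨f, hf, n, hn⟩ := (lt_omega0_opow hc).1 hx
      obtain ⟨g, hg, m, hm⟩ := (lt_omega0_opow hc).1 hy
      have key : ∀ k : ℕ, nadd (ω ^ max f g * n) (ω ^ max f g * k) =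
          ω ^ max f g * ((n + k : ℕ) : Ordinal) := by
        intro k
        induction k with
        | zero => simp [nadd_zero]
        | succ k ihk =>
          have h := ih _ (max_lt hf hg)
          rw [Nat.cast_succ, ← nadd_opow_eq h, ← nadd_assoc, ihk, nadd_opow_eq h]
          push_cast
          rw [add_assoc]
      have h₁ : x ≤ ω ^ max f g * n := hn.le.trans (by gcongr <;> simp)
      have h₂ : y ≤ ω ^ max f g * m := hm.le.trans (by gcongr <;> simp)
      refine (nadd_le_nadd h₁ h₂).trans_lt ?_
      rw [key]
      exact opow_mul_lt_opow (natCast_lt_omega0 _) (max_lt hf hg)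

theorem nadd_omega0_opow_of_dvd {c x : Ordinal.{u}} (h : ω ^ c ∣ x) :
    nadd x (ω ^ c) = x + ω ^ c := by
  obtain ⟨q, rfl⟩ := h
  rw [nadd_opow_eq (nadd_lt_omega0_opow c), mul_add, mul_one]

/-! ### Finite natural sums -/

/-- The ordinals with natural addition. -/
def NatOrd := Ordinal.{u}

noncomputable instance : LinearOrder NatOrd.{u} := inferInstanceAs (LinearOrder Ordinal.{u})

noncomputable instance : Add NatOrd.{u} := ⟨nadd⟩

noncomputable instance : Zero NatOrd.{u} := ⟨(0 : Ordinal.{u})⟩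

noncomputable instance : AddCommMonoid NatOrd.{u} where
  add_assoc := nadd_assoc
  zero_add := zero_nadd
  add_zero := nadd_zero
  add_comm := nadd_comm
  nsmul := nsmulRec

instance : IsOrderedCancelAddMonoid NatOrd.{u} where
  add_le_add_left _ _ h _ := nadd_le_nadd h le_rfl
  le_of_add_le_add_left a _ _ h :=
    (StrictMono.le_iff_le (f := nadd a) fun _ _ h => nadd_lt_nadd_left h a).1 h

/-- The natural sum of a finite family of ordinals. -/
noncomputable def nsum {κ : Type*} (s : Finset κ) (f : κ → Ordinal.{u}) : Ordinal.{u} :=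
  Finset.sum (M := NatOrd.{u}) s f

section

variable {κ : Type*} {s : Finset κ} {f g : κ → Ordinal.{u}}

theorem nsum_empty : nsum ∅ f = 0 := Finset.sum_empty (M := NatOrd.{u})

theorem nsum_insert [DecidableEq κ] {a : κ} (h : a ∉ s) :
    nsum (insert a s) f = nadd (f a) (nsum s f) :=
  Finset.sum_insert (M := NatOrd.{u}) h

theorem nsum_erase [DecidableEq κ] {a : κ} (h : a ∈ s) :
    nadd (f a) (nsum (s.erase a) f) = nsum s f :=
  Finset.add_sum_erase (M := NatOrd.{u}) s f h

theorem nsum_le_nsum (h : ∀ i ∈ s, f i ≤ g i) : nsum s f ≤ nsum s g :=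
  Finset.sum_le_sum (N := NatOrd.{u}) h

theorem nsum_lt_nsum (h : ∀ i ∈ s, f i ≤ g i) (h' : ∃ i ∈ s, f i < g i) : nsum s f < nsum s g :=
  Finset.sum_lt_sum (M := NatOrd.{u}) h h'

theorem nsum_congr (h : ∀ i ∈ s, f i = g i) : nsum s f = nsum s g :=
  Finset.sum_congr (M := NatOrd.{u}) rfl h

theorem nsum_update_lt [DecidableEq κ] {i : κ} (hi : i ∈ s) {x : Ordinal.{u}} (hx : x < f i) :
    nsum s (Function.update f i x) < nsum s f := by
  refine nsum_lt_nsum (fun j _ => ?_) ⟨i, hi, by simpa using hx⟩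
  rcases eq_or_ne j i with rfl | hj
  · simpa using hx.le
  · simp [hj]

theorem exists_le_nsum_update [DecidableEq κ] {t : Ordinal.{u}} (h : t < nsum s f) :
    ∃ i ∈ s, ∃ x < f i, t ≤ nsum s (Function.update f i x) := by
  induction s using Finset.induction_on generalizing t with
  | empty => exact absurd h (by simp [nsum_empty])
  | insert a s ha ih =>
    rw [nsum_insert ha] at h
    rcases lt_nadd_iff.1 h with ⟨x, hx, h⟩ | ⟨b, hb, h⟩
    · refine ⟨a, Finset.mem_insert_self _ _, x, hx, ?_⟩
      rw [nsum_insert ha, Function.update_self]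
      refine h.trans_eq (congrArg _ (nsum_congr fun i hi => ?_))
      rw [Function.update_of_ne (by rintro rfl; exact ha hi)]
    · obtain ⟨i, hi, x, hx, hb⟩ := ih hb
      refine ⟨i, Finset.mem_insert_of_mem hi, x, hx, ?_⟩
      rw [nsum_insert ha, Function.update_of_ne (by rintro rfl; exact ha hi)]
      exact h.trans (nadd_le_nadd le_rfl hb)

theorem nsum_lt_omega0_opow {c : Ordinal.{u}} (h : ∀ i ∈ s, f i < ω ^ c) : nsum s f < ω ^ c := by
  classical
  induction s using Finset.induction_on with
  | empty => simpa [nsum_empty] using opow_pos c omega0_pos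
  | insert a s ha ih =>
    rw [nsum_insert ha]
    exact nadd_lt_omega0_opow c _ (h _ (by simp)) _ (ih fun i hi => h i (by simp [hi]))

end

/-! ### Rank bounds for trees of sequences in a set -/

section

variable {A B : Type*} {R : A → A → Prop} {R' : B → B → Prop} {S T : Set A} {o a b : Ordinal.{u}}

/-- `LeRank R S o`: the tree of the finite sequences in `S` whose terms are pairwise related by `R`,
with the empty sequence as its root, has a root of rank at most `o`. -/
inductive LeRank (R : A → A → Prop) : Set A → Ordinal.{u} → Prop
  | intro (S : Set A) (o : Ordinal.{u}) (f : A → Ordinal.{u}) (hf : ∀ x ∈ S, f x < o)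
      (h : ∀ x ∈ S, LeRank R {y ∈ S | R x y} (f x)) : LeRank R S o

/-- `GeRank R S o`: the tree of the finite sequences in `S` whose terms are pairwise related by `R`,
with the empty sequence as its root, has a root of rank at least `o`. -/
inductive GeRank (R : A → A → Prop) : Set A → Ordinal.{u} → Prop
  | intro (S : Set A) (o : Ordinal.{u}) (f : ∀ a, a < o → A) (hf : ∀ a h, f a h ∈ S)
      (h : ∀ a h, GeRank R {y ∈ S | R (f a h) y} a) : GeRank R S o

theorem leRank_iff : LeRank R S o ↔ ∀ x ∈ S, ∃ o' < o, LeRank R {y ∈ S | R x y} o' := by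
  classical
  constructor
  · rintro ⟨_, _, f, hf, h⟩ x hx
    exact ⟨f x, hf x hx, h x hx⟩
  · intro h
    choose! f hf h using h
    exact ⟨S, o, f, hf, h⟩

theorem geRank_iff : GeRank R S o ↔ ∀ o' < o, ∃ x ∈ S, GeRank R {y ∈ S | R x y} o' := by
  constructor
  · rintro ⟨_, _, f, hf, h⟩ x hx
    exact ⟨f x hx, hf x hx, h x hx⟩
  · intro h
    choose f hf h using h
    exact ⟨S, o, f, hf, h⟩

theorem LeRank.mono (h : LeRank R S o) (hT : T ⊆ S) (ho : o ≤ a) : LeRank R T a := by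
  induction o using WellFoundedLT.induction generalizing S T a with
  | _ o ih =>
    refine leRank_iff.2 fun x hx => ?_
    obtain ⟨o', ho', h⟩ := leRank_iff.1 h x (hT hx)
    exact ⟨o', ho'.trans_le ho, ih o' ho' h (fun y hy => ⟨hT hy.1, hy.2⟩) le_rfl⟩

theorem GeRank.mono (h : GeRank R S o) (hT : S ⊆ T) (ho : a ≤ o) : GeRank R T a := by
  induction o using WellFoundedLT.induction generalizing S T a with
  | _ o ih =>
    refine geRank_iff.2 fun a' ha' => ?_
    obtain ⟨x, hx, h⟩ := geRank_iff.1 h a' (ha'.trans_le ho)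
    exact ⟨x, hT hx, ih a' (ha'.trans_le ho) h (fun y hy => ⟨hT hy.1, hy.2⟩) le_rfl⟩

theorem LeRank.comap {f : A → B} {S : Set B} (hf : ∀ x ∈ T, ∀ y ∈ T, R x y → R' (f x) (f y))
    (hT : Set.MapsTo f T S) (h : LeRank R' S o) : LeRank R T o := by
  induction o using WellFoundedLT.induction generalizing S T with
  | _ o ih =>
    refine leRank_iff.2 fun x hx => ?_
    obtain ⟨o', ho', h⟩ := leRank_iff.1 h _ (hT hx)
    refine ⟨o', ho', ih o' ho' (fun x hx y hy => hf x hx.1 y hy.1) ?_ h⟩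
    exact fun y hy => ⟨hT hy.1, hf _ hx _ hy.1 hy.2⟩

theorem GeRank.comap {f : A → B} {S : Set B} (hf : ∀ x y, R' (f x) (f y) → R x y)
    (hS : S ⊆ Set.range f) (h : GeRank R' S o) : GeRank R (f ⁻¹' S) o := by
  induction o using WellFoundedLT.induction generalizing S with
  | _ o ih =>
    refine geRank_iff.2 fun a ha => ?_
    obtain ⟨x, hx, h⟩ := geRank_iff.1 h a ha
    obtain ⟨x, rfl⟩ := hS hx
    exact ⟨x, hx, (ih a ha (fun y hy => hS hy.1) h).mono (fun y hy => ⟨hy.1, hf _ _ hy.2⟩) le_rfl⟩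

theorem GeRank.map {f : A → B} (hf : ∀ x y, R x y → R' (f x) (f y)) (h : GeRank R S o) :
    GeRank R' (f '' S) o := by
  induction o using WellFoundedLT.induction generalizing S with
  | _ o ih =>
    refine geRank_iff.2 fun a ha => ?_
    obtain ⟨x, hx, h⟩ := geRank_iff.1 h a ha
    refine ⟨f x, ⟨x, hx, rfl⟩, (ih a ha h).mono ?_ le_rfl⟩
    rintro _ ⟨y, hy, rfl⟩
    exact ⟨⟨y, hy.1, rfl⟩, hf _ _ hy.2⟩

theorem leRank_empty : LeRank R ∅ o := leRank_iff.2 fun _ h => h.elim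

theorem geRank_zero : GeRank R S (0 : Ordinal.{u}) := geRank_iff.2 fun _ h => absurd h not_lt_zero

/-- Each choice lowers the bound of the set it is taken from and does not raise the other, and
`nadd` is strictly monotone in both arguments. -/
theorem LeRank.union (hS : LeRank R S a) (hT : LeRank R T b) : LeRank R (S ∪ T) (nadd a b) := by
  induction a using WellFoundedLT.induction generalizing b S T with
  | _ a iha =>
    induction b using WellFoundedLT.induction generalizing S T with
    | _ b ihb =>
      refine leRank_iff.2 fun x hx => ?_
      rcases hx with hx | hx
      · obtain ⟨a', ha, h⟩ := leRank_iff.1 hS x hx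
        refine ⟨nadd a' b, nadd_lt_nadd_right ha b, ?_⟩
        exact (iha a' ha h (hT.mono (Set.sep_subset _ _) le_rfl)).mono
          (fun y hy => hy.1.imp (⟨·, hy.2⟩) (⟨·, hy.2⟩)) le_rfl
      · obtain ⟨b', hb, h⟩ := leRank_iff.1 hT x hx
        refine ⟨nadd a b', nadd_lt_nadd_left hb a, ?_⟩
        exact (ihb b' hb (hS.mono (Set.sep_subset _ _) le_rfl) h).mono
          (fun y hy => hy.1.imp (⟨·, hy.2⟩) (⟨·, hy.2⟩)) le_rfl

theorem LeRank.biUnion {κ : Type*} {s : Finset κ} {C : κ → Set A} {f : κ → Ordinal.{u}}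
    (h : ∀ i ∈ s, LeRank R (C i) (f i)) : LeRank R {x | ∃ i ∈ s, x ∈ C i} (nsum s f) := by
  classical
  induction s using Finset.induction_on with
  | empty => exact leRank_empty.mono (fun x hx => by simp at hx) le_rfl
  | insert i s hi ih =>
    rw [nsum_insert hi]
    refine ((h i (by simp)).union (ih fun j hj => h j (by simp [hj]))).mono ?_ le_rfl
    rintro x ⟨j, hj, hx⟩
    rcases Finset.mem_insert.1 hj with rfl | hj
    exacts [Or.inl hx, Or.inr ⟨j, hj, hx⟩]

/-- The first choice decides which of the two sets all later terms come from, so no sum is needed.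
-/
theorem LeRank.union_of_not_rel (hS : LeRank R S a) (hT : LeRank R T a)
    (h : ∀ x ∈ S, ∀ y ∈ T, ¬ R x y ∧ ¬ R y x) : LeRank R (S ∪ T) a := by
  refine leRank_iff.2 fun x hx => ?_
  rcases hx with hx | hx
  · obtain ⟨a', ha, h'⟩ := leRank_iff.1 hS x hx
    refine ⟨a', ha, h'.mono (fun y hy => ⟨?_, hy.2⟩) le_rfl⟩
    exact hy.1.resolve_right fun hyT => (h x hx y hyT).1 hy.2
  · obtain ⟨a', ha, h'⟩ := leRank_iff.1 hT x hx
    refine ⟨a', ha, h'.mono (fun y hy => ⟨?_, hy.2⟩) le_rfl⟩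
    exact hy.1.resolve_left fun hyS => (h y hyS x hx).2 hy.2

theorem leRank_one_of_not_rel (h : ∀ x ∈ S, ∀ y ∈ S, ¬ R x y) : LeRank R S (1 : Ordinal.{u}) :=
  leRank_iff.2 fun x hx => ⟨0, zero_lt_one,
    leRank_empty.mono (fun y hy => (h x hx y hy.1 hy.2).elim) le_rfl⟩

/-- If a family of sets of rank at least `b` is such that a member remains after any choice of
an element of `S`, then one may first choose in `S` and then in a member of the family. -/
theorem GeRank.union_of_family {𝒯 : Set (Set A)} (h𝒯 : ∀ T ∈ 𝒯, GeRank R T b)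
    (hS : ∀ T ∈ 𝒯, ∀ x ∈ S, ∃ T' ∈ 𝒯, T' ⊆ {y ∈ T | R x y}) (hT : T ∈ 𝒯) (h : GeRank R S a) :
    GeRank R (S ∪ T) (b + a) := by
  induction a using WellFoundedLT.induction generalizing S T with
  | _ a ih =>
    rcases eq_or_ne a 0 with rfl | ha
    · exact (h𝒯 T hT).mono Set.subset_union_right (by simp)
    refine geRank_iff.2 fun o ho => ?_
    obtain ⟨a', ha', ho⟩ := (Ordinal.lt_add_iff ha).1 ho
    obtain ⟨x, hx, h⟩ := geRank_iff.1 h a' ha'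
    obtain ⟨T', hT', hTT⟩ := hS T hT x hx
    refine ⟨x, Or.inl hx, (ih a' ha' (fun T hT y hy => hS T hT y hy.1) hT' h).mono ?_ ho⟩
    rintro y (hy | hy)
    exacts [⟨Or.inl hy.1, hy.2⟩, ⟨Or.inr (hTT hy).1, (hTT hy).2⟩]

end

/-! ### Comparison with the rank of the tree of nonempty sequences -/

section

variable {A : Type u} {R : A → A → Prop} [IsWellFounded (seqTree R) (IsChild (seqTree R))]
  {o : Ordinal.{u}}

theorem rank_le_of_leRank (s : seqTree R) (h : LeRank R {y | ∀ x ∈ s.1, R x y} o) :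
    IsWellFounded.rank (IsChild (seqTree R)) s ≤ o := by
  induction o using WellFoundedLT.induction generalizing s with
  | _ o ih =>
    rw [IsWellFounded.rank_eq]
    refine Ordinal.iSup_le fun ⟨t, y, hy⟩ => ?_
    have hp := t.2.2
    rw [hy, List.pairwise_append] at hp
    obtain ⟨o', ho', h⟩ := leRank_iff.1 h y fun x hx => hp.2.2 x hx y (by simp)
    refine succ_le_of_lt ((ih o' ho' t (h.mono (fun z hz => ?_) le_rfl)).trans_lt ho')
    simp only [hy, List.mem_append, List.mem_singleton] at hz
    exact ⟨fun x hx => hz x (Or.inl hx), hz y (Or.inr rfl)⟩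

theorem le_rank_of_geRank (s : seqTree R) (h : GeRank R {y | ∀ x ∈ s.1, R x y} o) :
    o ≤ IsWellFounded.rank (IsChild (seqTree R)) s := by
  induction o using WellFoundedLT.induction generalizing s with
  | _ o ih =>
    refine le_of_forall_lt fun a ha => ?_
    obtain ⟨y, hy, h⟩ := geRank_iff.1 h a ha
    let t : seqTree R := ⟨s.1 ++ [y], by simp,
      List.pairwise_append.2 ⟨s.2.2, by simp, fun x hx z hz => by simp_all⟩⟩
    have ht : IsChild (seqTree R) t s := ⟨y, rfl⟩
    refine (ih a ha t (h.mono (fun z hz => ?_) le_rfl)).trans_lt (IsWellFounded.rank_lt_of_rel ht)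
    intro x hx
    rcases List.mem_append.1 hx with hx | hx
    · exact hz.1 x hx
    · rw [List.mem_singleton.1 hx]
      exact hz.2

/-- The supremum of `r s + 1` in `treeRank` is the rank that the missing root, the empty sequence,
would have; `LeRank` and `GeRank` include that root. -/
theorem treeRank_le_of_leRank (h : LeRank R Set.univ o) : treeRank (seqTree R) ≤ o := by
  refine Ordinal.iSup_le fun s => succ_le_of_lt ?_
  obtain ⟨x, hx⟩ := List.exists_mem_of_ne_nil _ s.2.1
  obtain ⟨o', ho', h⟩ := leRank_iff.1 h x trivial
  exact (rank_le_of_leRank s (h.mono (fun y hy => ⟨trivial, hy x hx⟩) le_rfl)).trans_lt ho'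

theorem le_treeRank_of_geRank (h : GeRank R Set.univ o) : o ≤ treeRank (seqTree R) := by
  refine le_of_forall_lt fun a ha => ?_
  obtain ⟨x, -, h⟩ := geRank_iff.1 h a ha
  let s : seqTree R := ⟨[x], by simp, by simp⟩
  refine lt_of_le_of_lt (le_rank_of_geRank s (h.mono (fun y hy => ?_) le_rfl))
    ((lt_succ _).trans_le (Ordinal.le_iSup _ s))
  simpa [s] using hy.2

end

/-! ### Bad sequences and antichains in powers of the ordinals -/

/-- The relation of bad sequences, and for true `b` the relation of antichains. -/
def SeqRel {A : Type*} [Preorder A] (b : Prop) (x y : A) : Prop := ¬ x ≤ y ∧ (b → ¬ y ≤ x)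

section

variable {ι : Type*} {b : Prop} {S T : Set (ι → Ordinal.{u})}
  {γ δ : Ordinal.{u}}

theorem GeRank.translate (h : GeRank (SeqRel b) S γ) (z : ι → Ordinal.{u}) :
    GeRank (SeqRel b) ((z + ·) '' S) γ := by
  have hz : ∀ x y : ι → Ordinal.{u}, z + x ≤ z + y ↔ x ≤ y := fun x y => by simp [Pi.le_def]
  exact h.map fun x y hxy => by simpa only [SeqRel, hz] using hxy

theorem LeRank.translate (h : LeRank (SeqRel b) S γ) (z : ι → Ordinal.{u}) :
    LeRank (SeqRel b) ((z + ·) '' S) γ := by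
  refine h.comap (f := (· - z)) ?_ ?_
  · rintro _ ⟨x, -, rfl⟩ _ ⟨y, -, rfl⟩ hxy
    simpa [SeqRel, Pi.le_def] using hxy
  · rintro _ ⟨x, hx, rfl⟩
    convert hx
    ext i
    simp

/-- The choices in `S` come first; the coordinate `l` keeps them incomparable to those in `T`. -/
theorem GeRank.union_of_separated [DecidableEq ι] (hT : GeRank (SeqRel b) T γ) (hS : GeRank (SeqRel b) S δ)
    (hST : ∀ x ∈ S, ∀ y ∈ T, ¬ x ≤ y)
    (hb : b → ∃ (l : ι) (a : Ordinal.{u}), IsSuccLimit a ∧ (∀ x ∈ S, x l < a) ∧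
      ∀ y ∈ T, ∀ c < a, Pi.single l c + y ∈ T) :
    GeRank (SeqRel b) (S ∪ T) (γ + δ) := by
  by_cases h : b
  · obtain ⟨l, a, ha, hSa, hTa⟩ := hb h
    have key : GeRank (SeqRel b) (S ∪ {y ∈ T | 0 ≤ y l}) (γ + δ) := by
      -- Truncating `T` at a height `c < a` keeps its rank, as it still contains a translate of `T`.
      -- After a choice `x` the threshold rises above `x l`, so nothing left in `T` is below `x`.
      refine GeRank.union_of_family (𝒯 := {T' | ∃ c < a, T' = {y ∈ T | c ≤ y l}}) ?_ ?_
        ⟨0, ha.bot_lt, rfl⟩ hS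
      · rintro _ ⟨c, hc, rfl⟩
        refine (hT.translate (Pi.single l c)).mono ?_ le_rfl
        rintro _ ⟨y, hy, rfl⟩
        exact ⟨hTa y hy c hc, by simp⟩
      · rintro _ ⟨c, hc, rfl⟩ x hx
        refine ⟨_, ⟨max c (x l + 1), max_lt hc (ha.succ_lt (hSa x hx)), rfl⟩, ?_⟩
        rintro y ⟨hy, hcy⟩
        refine ⟨⟨hy, (le_max_left _ _).trans hcy⟩, hST x hx y hy, fun _ hyx => ?_⟩
        exact (lt_add_one (x l)).not_ge (((le_max_right _ _).trans hcy).trans (hyx l))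
    exact key.mono (by simp) le_rfl
  · refine GeRank.union_of_family (𝒯 := {T}) (by simpa using hT) ?_ rfl hS
    rintro _ rfl x hx
    exact ⟨_, rfl, fun y hy => ⟨hy, hST x hx y hy, fun hb => (h hb).elim⟩⟩

end

/-! ### Ranks of boxes -/

section

variable {ι : Type*} {b : Prop}

/-- The box of the points `x` with `lo i ≤ x i < lo i + sz i` for all `i`. -/
def box (lo sz : ι → Ordinal.{u}) : Set (ι → Ordinal.{u}) :=
  {x | ∀ i, lo i ≤ x i ∧ x i < lo i + sz i}

theorem box_eq_image (lo sz : ι → Ordinal.{u}) : box lo sz = (lo + ·) '' box 0 sz := by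
  ext x
  constructor
  · intro h
    refine ⟨x - lo, fun i => ⟨zero_le, ?_⟩, ?_⟩
    · have := (h i).2
      simp only [Pi.sub_apply, Pi.zero_apply, zero_add]
      rwa [← Ordinal.add_sub_cancel_of_le (h i).1, add_lt_add_iff_left] at this
    · ext i
      exact Ordinal.add_sub_cancel_of_le (h i).1
  · rintro ⟨y, hy, rfl⟩ i
    have := (hy i).2
    simp only [Pi.zero_apply, zero_add] at this
    exact ⟨le_self_add, by simpa using this⟩

theorem LeRank.box {lo sz : ι → Ordinal.{u}} {o : Ordinal.{u}}
    (h : LeRank (SeqRel b) (box 0 sz) o) : LeRank (SeqRel b) (box lo sz) o :=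
  box_eq_image lo sz ▸ h.translate lo

theorem GeRank.box {lo sz : ι → Ordinal.{u}} {o : Ordinal.{u}}
    (h : GeRank (SeqRel b) (box 0 sz) o) : GeRank (SeqRel b) (box lo sz) o :=
  box_eq_image lo sz ▸ h.translate lo

theorem opow_update [DecidableEq ι] (e : ι → Ordinal.{u}) (i : ι) (f : Ordinal.{u}) :
    (fun j => ω ^ Function.update e i f j) = Function.update (fun j => ω ^ e j) i (ω ^ f) := by
  ext j
  by_cases h : j = i
  · subst h; simp
  · simp [h]

theorem geRank_of_forall_lt {A : Type*} {R : A → A → Prop} {S : Set A} {o : Ordinal.{u}}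
    (h : ∀ a < o, ∃ a' > a, GeRank R S a') : GeRank R S o := by
  refine geRank_iff.2 fun a ha => ?_
  obtain ⟨a', ha', h⟩ := h a ha
  exact geRank_iff.1 h a ha'

theorem box_update_zero [DecidableEq ι] (z : ι → Ordinal.{u}) (i : ι) :
    box 0 (Function.update z i 0) = ∅ := by
  refine Set.eq_empty_iff_forall_notMem.2 fun x hx => ?_
  simpa using (hx i).2

theorem box_update_add [DecidableEq ι] (z : ι → Ordinal.{u}) (i : ι) (a c : Ordinal.{u}) :
    box 0 (Function.update z i (a + c)) =
      box (Pi.single i a) (Function.update z i c) ∪ box 0 (Function.update z i a) := by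
  ext x
  constructor
  · intro h
    rcases le_or_gt a (x i) with ha | ha
    · refine Or.inl fun j => ?_
      by_cases hj : j = i
      · subst hj; simpa [ha] using h j
      · simpa [hj] using h j
    · refine Or.inr fun j => ?_
      by_cases hj : j = i
      · subst hj; simpa using ha
      · simpa [hj] using h j
  · rintro (h | h) j
    · by_cases hj : j = i
      · subst hj; simpa using (h j).2
      · simpa [hj] using h j
    · by_cases hj : j = i
      · subst hj
        refine ⟨zero_le, (h j).2.trans_le ?_⟩
        simp
      · simpa [hj] using h j

/-- The box is a stack of `n` translated slabs of thickness `f`, and finitely many copies of `ω ^ g`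
have a natural sum below `ω ^ c`. -/
theorem exists_leRank_slab [DecidableEq ι] {z : ι → Ordinal.{u}} {i : ι} {f g c : Ordinal.{u}}
    (h : LeRank (SeqRel b) (box 0 (Function.update z i f)) (ω ^ g)) (hg : g < c) (n : ℕ) :
    ∃ o < ω ^ c, LeRank (SeqRel b) (box 0 (Function.update z i (f * n))) o := by
  induction n with
  | zero =>
    refine ⟨0, opow_pos c omega0_pos, ?_⟩
    rw [Nat.cast_zero, mul_zero, box_update_zero]
    exact leRank_empty
  | succ n ih =>
    obtain ⟨o, ho, ih⟩ := ih
    refine ⟨nadd (ω ^ g) o,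
      nadd_lt_omega0_opow c _ ((opow_lt_opow_iff_right one_lt_omega0).2 hg) _ ho, ?_⟩
    rw [Nat.cast_succ, mul_add, mul_one, box_update_add]
    exact h.box.union ih

/-- The slabs are used from the top down, so no later point is above an earlier one. For antichains,
a coordinate `l` other than the slicing direction prevents the opposite comparison. -/
theorem geRank_slab [DecidableEq ι] {z : ι → Ordinal.{u}} {i : ι} {f γ : Ordinal.{u}}
    (h : GeRank (SeqRel b) (box 0 (Function.update z i f)) γ)
    (hb : b → ∃ l ≠ i, IsSuccLimit (z l) ∧ IsPrincipal (· + ·) (z l)) (n : ℕ) :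
    GeRank (SeqRel b) (box 0 (Function.update z i (f * n))) (γ * n) := by
  induction n with
  | zero => simpa using geRank_zero
  | succ n ih =>
    rw [Nat.cast_succ, mul_add, mul_one, box_update_add, mul_add, mul_one]
    refine ih.union_of_separated h.box (fun x hx y hy hxy => ?_) fun h' => ?_
    · have h₁ := (hx i).1.trans (hxy i)
      have h₂ := (hy i).2
      simp only [Pi.single_eq_same, Function.update_self, Pi.zero_apply, zero_add] at h₁ h₂
      exact h₂.not_ge h₁
    · obtain ⟨l, hl, hlim, hprin⟩ := hb h'
      refine ⟨l, z l, hlim, fun x hx => ?_, fun y hy c hc j => ?_⟩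
      · simpa [hl] using (hx l).2
      · by_cases hj : j = l
        · subst hj
          have := (hy j).2
          simp only [Pi.zero_apply, Function.update_of_ne hl, zero_add] at this
          simpa [hl] using hprin hc this
        · simpa [hj] using (hy j).2

variable [Fintype ι] [DecidableEq ι]

/-- After a choice `x`, every later point is smaller than `x` in some coordinate `i`, hence lies in
a slab of thickness `x i ≤ ω ^ f * n` with `f < e i`. As `g` drops when `e i` drops to `f`, the
finitely many slabs together stay below `ω ^ g e`. The first alternative in `hg` covers exponents
where `g` cannot drop. -/
theorem leRank_box_of_decreasing (g : (ι → Ordinal.{u}) → Ordinal.{u})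
    (hg : ∀ e : ι → Ordinal.{u}, LeRank (SeqRel b) (box 0 fun i => ω ^ e i) (ω ^ g e) ∨
      ∀ i, ∀ f < e i, g (Function.update e i f) < g e) (e : ι → Ordinal.{u}) :
    LeRank (SeqRel b) (box 0 fun i => ω ^ e i) (ω ^ g e) := by
  induction h : nsum Finset.univ e using WellFoundedLT.induction generalizing e with
  | _ s ih =>
    subst h
    refine (hg e).elim id fun hg => leRank_iff.2 fun x hx => ?_
    have key : ∀ i, ∃ o < ω ^ g e,
        LeRank (SeqRel b) (box 0 (Function.update (fun j => ω ^ e j) i (x i))) o := by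
      intro i
      have hxi := (hx i).2
      simp only [Pi.zero_apply, zero_add] at hxi
      rcases eq_or_ne (e i) 0 with hi | hi
      · rw [hi, opow_zero, Order.lt_one_iff] at hxi
        refine ⟨0, opow_pos _ omega0_pos, ?_⟩
        rw [hxi, box_update_zero]
        exact leRank_empty
      · obtain ⟨f, hf, n, hn⟩ := (lt_omega0_opow hi).1 hxi
        have h := ih _ (nsum_update_lt (Finset.mem_univ i) hf) (Function.update e i f) rfl
        rw [opow_update] at h
        obtain ⟨o, ho, h⟩ := exists_leRank_slab h (hg i f hf) n
        refine ⟨o, ho, h.mono (fun y hy j => ⟨zero_le, (hy j).2.trans_le ?_⟩) le_rfl⟩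
        by_cases hj : j = i
        · subst hj; simpa using hn.le
        · simp [hj]
    choose o ho h using key
    refine ⟨nsum Finset.univ o, nsum_lt_omega0_opow fun i _ => ho i,
      (LeRank.biUnion fun i _ => h i).mono ?_ le_rfl⟩
    rintro y ⟨hy, hxy, -⟩
    rw [Pi.le_def, not_forall] at hxy
    obtain ⟨i, hi⟩ := hxy
    refine ⟨i, Finset.mem_univ i, fun j => ⟨zero_le, ?_⟩⟩
    by_cases hj : j = i
    · subst hj; simpa using hi
    · simpa [hj] using (hy j).2

theorem leRank_box_opow (e : ι → Ordinal.{u}) :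
    LeRank (SeqRel b) (box 0 fun i => ω ^ e i) (ω ^ nsum Finset.univ e) :=
  leRank_box_of_decreasing _ (fun _ => Or.inr fun i _ hf => nsum_update_lt (Finset.mem_univ i) hf) e

theorem le_nsum {κ : Type*} {s : Finset κ} (f : κ → Ordinal.{u}) {i : κ} (h : i ∈ s) :
    f i ≤ nsum s f := by
  classical
  rw [← nsum_erase h]
  exact le_self_add.trans (add_le_nadd _ _)

omit [Fintype ι] in
theorem leRank_box_of_chain (hb : b) {e : ι → Ordinal.{u}} (j : ι) (h : ∀ i ≠ j, e i = 0) :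
    LeRank (SeqRel b) (box 0 fun i => ω ^ e i) (1 : Ordinal.{u}) := by
  refine leRank_one_of_not_rel fun x hx y hy hxy => ?_
  have hz : ∀ x ∈ box 0 fun i => ω ^ e i, ∀ i ≠ j, x i = 0 := fun x hx i hi => by
    simpa [h i hi] using (hx i).2
  have : ∀ x ∈ box 0 fun i => ω ^ e i, ∀ y ∈ box 0 fun i => ω ^ e i, x j ≤ y j → x ≤ y := by
    intro x hx y hy hxy i
    by_cases hi : i = j
    · exact hi ▸ hxy
    · rw [hz x hx i hi, hz y hy i hi]
  rcases le_total (x j) (y j) with h | h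
  · exact hxy.1 (this x hx y hy h)
  · exact hxy.2 hb (this y hy x hx h)

/-- Ordinal subtraction removes the `1` on the left, so infinite ordinals are unchanged. The case `a
= 0` fails because `0 - 1 = 1 - 1`. -/
theorem sub_one_lt_sub_one {a c : Ordinal.{u}} (ha : a ≠ 0) (h : a < c) : a - 1 < c - 1 := by
  by_contra! h'
  have h₁ : 1 ≤ a := Order.one_le_iff_ne_zero.2 ha
  refine h.not_ge ?_
  rw [← Ordinal.add_sub_cancel_of_le h₁, ← Ordinal.add_sub_cancel_of_le (h₁.trans h.le)]
  gcongr

/-- The antichains of a box `∏ ω ^ e i` lose one in the exponent, unless there is at most one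
nontrivial factor. -/
theorem leRank_antichain_box (hb : b) (i₀ : ι) (e : ι → Ordinal.{u}) :
    LeRank (SeqRel b) (box 0 fun i => ω ^ e i)
      (ω ^ (if nsum (Finset.univ.erase i₀) e = 0 then 0 else
        nadd (e i₀) (nsum (Finset.univ.erase i₀) e - 1))) := by
  refine leRank_box_of_decreasing (fun e => if nsum (Finset.univ.erase i₀) e = 0 then 0 else
        nadd (e i₀) (nsum (Finset.univ.erase i₀) e - 1)) (fun e => ?_) e
  have hmem : ∀ {j}, j ≠ i₀ → j ∈ Finset.univ.erase i₀ := fun hj => by simp [hj]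
  by_cases hD : nsum (Finset.univ.erase i₀) e = 0
  · left
    rw [if_pos hD, opow_zero]
    exact leRank_box_of_chain hb i₀ fun j hj => nonpos_iff_eq_zero.1 (hD ▸ le_nsum e (hmem hj))
  -- A zero value cannot drop further. Here it means that the only nonzero exponent is a `1` away
  -- from `i₀`, so the box is a chain.
  by_cases hg : nadd (e i₀) (nsum (Finset.univ.erase i₀) e - 1) = 0
  · left
    rw [if_neg hD, hg, opow_zero]
    have h₁ : e i₀ = 0 := nonpos_iff_eq_zero.1 (hg ▸ le_self_add.trans (add_le_nadd _ _))
    have h₂ : nsum (Finset.univ.erase i₀) e = 1 := by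
      rw [h₁, zero_nadd] at hg
      rw [← Ordinal.add_sub_cancel_of_le (Order.one_le_iff_ne_zero.2 hD), hg, add_zero]
    obtain ⟨j, hj, hj0⟩ : ∃ j ∈ Finset.univ.erase i₀, e j ≠ 0 := by
      by_contra! h
      refine hD (nonpos_iff_eq_zero.1 ?_)
      rw [← not_lt]
      intro h'
      obtain ⟨i, hi, x, hx, -⟩ := exists_le_nsum_update h'
      simp [h i hi] at hx
    refine leRank_box_of_chain hb j fun i hi => ?_
    by_cases hi₀ : i = i₀
    · rw [hi₀, h₁]
    have h₃ : nadd 1 (nsum ((Finset.univ.erase i₀).erase j) e) ≤ nadd 1 0 := by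
      refine (nadd_le_nadd (Order.one_le_iff_ne_zero.2 hj0) le_rfl).trans_eq ?_
      rw [nsum_erase hj, h₂, nadd_zero]
    by_contra h0
    refine h₃.not_gt (nadd_lt_nadd_left ?_ 1)
    exact (pos_iff_ne_zero.2 h0).trans_le (le_nsum e (by simp [hi, hi₀]))
  · right
    intro i f hf
    simp only [if_neg hD]
    split_ifs with h
    · exact pos_iff_ne_zero.2 hg
    by_cases hi : i = i₀
    · subst hi
      rw [Function.update_self, nsum_congr (g := e) fun j hj => Function.update_of_ne
        (Finset.ne_of_mem_erase hj) _ _]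
      exact nadd_lt_nadd_right hf _
    · rw [Function.update_of_ne (Ne.symm hi)]
      exact nadd_lt_nadd_left (sub_one_lt_sub_one h (nsum_update_lt (hmem hi) hf)) _

/-- Away from `i₀` the exponents have a finite sum, from which subtracting one is a real loss. If
that sum is `0`, the box is a chain, and `h₀` makes its antichain bound `1` too small. -/
theorem exists_leRank_antichain_box_lt (hb : b) {i₀ : ι} {e : ι → Ordinal.{u}} (h₀ : e i₀ ≠ 0)
    (h : ∀ i ≠ i₀, e i < ω) :
    ∃ o < ω ^ nsum Finset.univ e, LeRank (SeqRel b) (box 0 fun i => ω ^ e i) o := by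
  refine ⟨_, (opow_lt_opow_iff_right one_lt_omega0).2 ?_, leRank_antichain_box hb i₀ e⟩
  rw [← nsum_erase (Finset.mem_univ i₀)]
  split_ifs with hD
  · rw [hD, nadd_zero]
    exact pos_iff_ne_zero.2 h₀
  · have : nsum (Finset.univ.erase i₀) e < ω ^ (1 : Ordinal.{u}) :=
      nsum_lt_omega0_opow fun i hi => by simpa using h i (Finset.ne_of_mem_erase hi)
    rw [opow_one] at this
    obtain ⟨n, hn⟩ := lt_omega0.1 this
    rw [hn] at hD ⊢
    refine nadd_lt_nadd_left ?_ _
    rw [← Ne, Nat.cast_ne_zero] at hD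
    rw [← Nat.cast_one, ← Ordinal.natCast_sub, Nat.cast_lt]
    omega

/-- Sides in `J` have the form `ω ^ (1 + e)`, a limit even for `e = 0`, and can serve as separating
coordinate. Two of them are needed, since the slicing direction may use up one. For bad sequences
`J` may be empty. -/
theorem geRank_box_opow {J : Finset ι} (hJ : b → ∃ j₁ ∈ J, ∃ j₂ ∈ J, j₁ ≠ j₂)
    (e : ι → Ordinal.{u}) :
    GeRank (SeqRel b) (box 0 fun i => ω ^ if i ∈ J then 1 + e i else e i)
      (ω ^ nsum Finset.univ e) := by
  induction h : nsum Finset.univ e using WellFoundedLT.induction generalizing e with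
  | _ s ih =>
    subst h
    rcases eq_or_ne (nsum Finset.univ e) 0 with h0 | h0
    · rw [h0, opow_zero]
      refine geRank_iff.2 fun a ha => ⟨0, fun i => ⟨le_rfl, ?_⟩, ?_⟩
      · simpa only [Pi.zero_apply, zero_add] using opow_pos _ omega0_pos
      · rw [Order.lt_one_iff.1 ha]
        exact geRank_zero
    refine geRank_of_forall_lt fun a ha => ?_
    obtain ⟨t, ht, n, hn⟩ := (lt_omega0_opow h0).1 ha
    -- Lowering one exponent `e i` to `f` still leaves a sum of at least `t`, so `n` slabs of
    -- thickness given by `f` exceed the target `a < ω ^ t * n`.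
    obtain ⟨i, -, f, hf, htf⟩ := exists_le_nsum_update ht
    refine ⟨_, hn, ?_⟩
    have h := ih _ (nsum_update_lt (Finset.mem_univ i) hf) (Function.update e i f) rfl
    have hupd : (fun j => ω ^ if j ∈ J then 1 + Function.update e i f j else
        Function.update e i f j) = Function.update (fun j => ω ^ if j ∈ J then 1 + e j else e j) i
          (ω ^ if i ∈ J then 1 + f else f) := by
      ext j
      by_cases hj : j = i
      · subst hj; simp
      · simp [hj]
    rw [hupd] at h
    refine (geRank_slab h (fun hb => ?_) n).mono (fun y hy j => ⟨zero_le, (hy j).2.trans_le ?_⟩) ?_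
    · obtain ⟨l, hl, hli⟩ : ∃ l ∈ J, l ≠ i := by
        obtain ⟨j₁, h₁, j₂, h₂, hne⟩ := hJ hb
        by_cases h : j₁ = i
        · exact ⟨j₂, h₂, fun h' => hne (h.trans h'.symm)⟩
        · exact ⟨j₁, h₁, h⟩
      refine ⟨l, hli, ?_, isPrincipal_add_omega0_opow _⟩
      rw [if_pos hl]
      exact isSuccLimit_opow_left isSuccLimit_omega0 (by simp)
    · by_cases hj : j = i
      · subst hj
        simp only [Pi.zero_apply, zero_add, Function.update_self]
        refine (opow_mul_lt_opow (natCast_lt_omega0 _) ?_).le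
        split_ifs
        · gcongr
        · exact hf
      · simp [hj]
    · gcongr
      exact omega0_pos

end

/-! ### Decomposition along the Cantor normal form -/

/-- A decomposition of the ordinal `β` into consecutive intervals, the `k`-th of which starts at
`lo k` and has the order type `ω ^ exp k`, with nonincreasing exponents. -/
structure OmegaSum (β : Ordinal.{u}) where
  len : ℕ
  exp : Fin len → Ordinal.{u}
  lo : Fin len → Ordinal.{u}
  antitone_exp : Antitone exp
  covers : ∀ x < β, ∃ k, lo k ≤ x ∧ x < lo k + ω ^ exp k
  add_le : ∀ k, lo k + ω ^ exp k ≤ β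
  separated : ∀ k k', k < k' → lo k + ω ^ exp k ≤ lo k'
  dvd_iff : ∀ c, ω ^ c ∣ β ↔ ∀ k, c ≤ exp k
  exists_le_exp : ∀ c, ω ^ c ≤ β → ∃ k, c ≤ exp k

theorem nonempty_omegaSum (β : Ordinal.{u}) : Nonempty (OmegaSum β) := by
  induction β using WellFoundedLT.induction with
  | _ β ih =>
    rcases eq_or_ne β 0 with rfl | hβ
    · exact ⟨⟨0, Fin.elim0, Fin.elim0, fun k => k.elim0, fun x hx => absurd hx not_lt_zero,
        fun k => k.elim0, fun k => k.elim0, fun c => ⟨fun _ k => k.elim0, fun _ => dvd_zero _⟩,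
        fun c hc => absurd hc (opow_pos c omega0_pos).not_ge⟩⟩
    -- The leading power `ω ^ log ω β` is split off once, so a coefficient in the normal form
    -- becomes a repetition of equal exponents.
    obtain ⟨D⟩ := ih _ (sub_omega0_opow_log_lt hβ)
    have hle : ω ^ log ω β ≤ β := opow_log_le_self ω hβ
    have hadd : ω ^ log ω β + (β - ω ^ log ω β) = β := Ordinal.add_sub_cancel_of_le hle
    have hexp : ∀ k, D.exp k ≤ log ω β := fun k =>
      (opow_le_iff_le_log one_lt_omega0 hβ).1
        ((le_add_self.trans (D.add_le k)).trans (Ordinal.sub_le_self _ _))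
    refine ⟨⟨D.len + 1, Fin.cons (log ω β) D.exp, Fin.cons 0 fun k => ω ^ log ω β + D.lo k,
      ?_, ?_, ?_, ?_, ?_, ?_⟩⟩
    · intro k k' hk
      induction k using Fin.cases with
      | zero => induction k' using Fin.cases with
        | zero => rfl
        | succ k' => simpa using hexp k'
      | succ k => induction k' using Fin.cases with
        | zero => exact absurd hk (by simp)
        | succ k' => simpa using D.antitone_exp (Fin.succ_le_succ_iff.1 hk)
    · intro x hx
      rcases lt_or_ge x (ω ^ log ω β) with h | h
      · exact ⟨0, by simpa using h⟩
      · obtain ⟨k, hk, hk'⟩ := D.covers (x - ω ^ log ω β)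
          (by rwa [← add_lt_add_iff_left (ω ^ log ω β), hadd, Ordinal.add_sub_cancel_of_le h])
        refine ⟨k.succ, ?_⟩
        rw [← Ordinal.add_sub_cancel_of_le h]
        simpa [add_assoc] using ⟨hk, hk'⟩
    · intro k
      induction k using Fin.cases with
      | zero => simpa using hle
      | succ k =>
        simp only [Fin.cons_succ, add_assoc]
        exact (add_le_add_right (D.add_le k) _).trans_eq hadd
    · intro k k' hk
      induction k' using Fin.cases with
      | zero => exact absurd hk (by simp)
      | succ k' => induction k using Fin.cases with
        | zero => simp
        | succ k => simpa [add_assoc] using D.separated k k' (by simpa using hk)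
    · intro c
      rw [Fin.forall_fin_succ]
      simp only [Fin.cons_zero, Fin.cons_succ]
      rw [← D.dvd_iff]
      constructor
      · intro h
        have hc : c ≤ log ω β :=
          (opow_le_iff_le_log one_lt_omega0 hβ).1 (Ordinal.le_of_dvd hβ h)
        refine ⟨hc, ?_⟩
        rw [← hadd] at h
        exact (Ordinal.dvd_add_iff (opow_dvd_opow ω hc)).1 h
      · rintro ⟨hc, h⟩
        rw [← hadd]
        exact (Ordinal.dvd_add_iff (opow_dvd_opow ω hc)).2 h
    · exact fun c hc => ⟨0, by simpa using (opow_le_iff_le_log one_lt_omega0 hβ).1 hc⟩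

namespace OmegaSum

variable {β : Ordinal.{u}} (D : OmegaSum β)

theorem exists_lo_eq_zero (hβ : β ≠ 0) : ∃ k, D.lo k = 0 ∧ ∀ k', k ≤ k' := by
  obtain ⟨k, hk, -⟩ := D.covers 0 (pos_iff_ne_zero.2 hβ)
  refine ⟨k, nonpos_iff_eq_zero.1 hk, fun k' => ?_⟩
  by_contra! h
  exact (opow_pos _ omega0_pos).not_ge (le_add_self.trans ((D.separated _ _ h).trans hk))

/-- The first interval has the largest exponent and therefore already fills `β = ω ^ a`; a second
one would overshoot. -/
theorem eq_of_isPrincipal (hβ : β ≠ 0) (h : IsPrincipal (· + ·) β) (k : Fin D.len) :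
    D.lo k = 0 ∧ ω ^ D.exp k = β := by
  obtain ⟨a, rfl⟩ := (isPrincipal_add_iff_zero_or_omega0_opow.1 h).resolve_left hβ
  obtain ⟨k₀, hk₀, hmin⟩ := D.exists_lo_eq_zero hβ
  obtain ⟨k₁, hk₁⟩ := D.exists_le_exp a le_rfl
  have h₀ : ω ^ D.exp k₀ = ω ^ a := by
    refine le_antisymm (le_add_self.trans (D.add_le k₀)) ?_
    exact opow_le_opow_right omega0_pos (hk₁.trans (D.antitone_exp (hmin k₁)))
  rcases (hmin k).eq_or_lt with rfl | hk
  · exact ⟨hk₀, h₀⟩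
  · have h₁ := D.separated _ _ hk
    have h₂ := D.add_le k
    rw [hk₀, zero_add, h₀] at h₁
    exact absurd ((lt_add_of_pos_right _ (opow_pos _ omega0_pos)).trans_le h₂) h₁.not_gt

theorem exists_lt_of_not_isPrincipal (h : ¬ IsPrincipal (· + ·) β) : ∃ k k' : Fin D.len, k < k' := by
  have hβ : β ≠ 0 := by rintro rfl; simp at h
  by_contra! h'
  obtain ⟨k, hk, -⟩ := D.exists_lo_eq_zero hβ
  have hle := D.add_le k
  rw [hk, zero_add] at hle
  refine h ?_
  rcases hle.eq_or_lt with he | hlt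
  · rw [← he]
    exact isPrincipal_add_omega0_opow _
  · obtain ⟨k', h₁, h₂⟩ := D.covers _ hlt
    obtain rfl := le_antisymm (h' k' k) (h' k k')
    simp [hk] at h₂

end OmegaSum

/-- When the term of least exponent is added last, the natural sum is an ordinary sum of multiples
of `ω ^ c`. -/
theorem dvd_nsum_opow {κ : Type*} (g : κ → Ordinal.{u}) (s : Finset κ) {c : Ordinal.{u}}
    (h : ∀ i ∈ s, c ≤ g i) : ω ^ c ∣ nsum s (fun i => ω ^ g i) := by
  classical
  induction s using Finset.strongInduction generalizing c with
  | _ s ih =>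
    rcases s.eq_empty_or_nonempty with rfl | hs
    · rw [nsum_empty]
      exact dvd_zero _
    obtain ⟨p, hp, hmin⟩ := s.exists_min_image g hs
    rw [← nsum_erase hp, nadd_comm, nadd_omega0_opow_of_dvd
      (ih _ (Finset.erase_ssubset hp) fun i hi => hmin i (Finset.mem_of_mem_erase hi))]
    exact dvd_add (ih _ (Finset.erase_ssubset hp) fun i hi => h i (Finset.mem_of_mem_erase hi))
      (opow_dvd_opow ω (h p hp))

/-! ### Products cut into pieces -/

section

variable {ι : Type*} {b : Prop} {β : ι → Ordinal.{u}} (D : ∀ i, OmegaSum (β i))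

/-- The box of a choice of one interval from the decomposition of each `β i`. -/
def piece (p : ∀ i, Fin (D i).len) : Set (ι → Ordinal.{u}) :=
  box (fun i => (D i).lo (p i)) fun i => ω ^ (D i).exp (p i)

variable {D} in
theorem le_of_mem_piece {p q : ∀ i, Fin (D i).len} {x y : ι → Ordinal.{u}} (hx : x ∈ piece D p)
    (hy : y ∈ piece D q) (h : x ≤ y) : p ≤ q := by
  intro i
  by_contra! hi
  exact (((hx i).1.trans (h i)).trans_lt (hy i).2).not_ge ((D i).separated _ _ hi)

theorem pieces_subset_box (S : Finset (∀ i, Fin (D i).len)) :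
    {x | ∃ p ∈ S, x ∈ piece D p} ⊆ box 0 β := by
  rintro x ⟨p, -, hp⟩ i
  simpa using (hp i).2.trans_le ((D i).add_le _)

variable [Fintype ι]

/-- The exponent of the natural product of the sides of a piece. -/
noncomputable def weight (p : ∀ i, Fin (D i).len) : Ordinal.{u} :=
  nsum Finset.univ fun i => (D i).exp (p i)

theorem weight_antitone : Antitone (weight D) := fun _ _ h =>
  nsum_le_nsum fun i _ => (D i).antitone_exp (h i)

variable [DecidableEq ι]

theorem box_subset_pieces : box 0 β ⊆ {x | ∃ p ∈ Finset.univ, x ∈ piece D p} := by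
  intro x hx
  have : ∀ i, ∃ k, (D i).lo k ≤ x i ∧ x i < (D i).lo k + ω ^ (D i).exp k := fun i =>
    (D i).covers _ (by simpa using (hx i).2)
  choose p hp using this
  exact ⟨p, Finset.mem_univ p, hp⟩

theorem leRank_piece (p : ∀ i, Fin (D i).len) :
    LeRank (SeqRel b) (piece D p) (ω ^ weight D p) := by
  exact (leRank_box_opow _).box

theorem leRank_box_nsum :
    LeRank (SeqRel b) (box 0 β) (nsum Finset.univ fun p => ω ^ weight D p) :=
  (LeRank.biUnion fun p _ => leRank_piece D p).mono (box_subset_pieces D) le_rfl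

/-- The pieces are used one after another, and ranks then add as an ordinary sum. Using them in
order of increasing weight makes this the natural sum. -/
theorem geRank_box_nsum (hp : ∀ p, GeRank (SeqRel b) (piece D p) (ω ^ weight D p))
    (hb : b → ∃ l, ω ≤ β l ∧ IsPrincipal (· + ·) (β l)) :
    GeRank (SeqRel b) (box 0 β) (nsum Finset.univ fun p => ω ^ weight D p) := by
  suffices ∀ S : Finset (∀ i, Fin (D i).len), GeRank (SeqRel b) {x | ∃ p ∈ S, x ∈ piece D p}
      (nsum S fun p => ω ^ weight D p) from (this _).mono (pieces_subset_box D _) le_rfl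
  intro S
  induction S using Finset.strongInduction with
  | _ S ih =>
    rcases S.eq_empty_or_nonempty with rfl | hS
    · rw [nsum_empty]
      exact geRank_zero
    obtain ⟨p₀, hp₀, hmin₀⟩ := S.exists_min_image (weight D) hS
    -- Least weight makes the natural sum ordinary; maximality among ties, with `weight_antitone`,
    -- ensures that no other piece of `S` has a point above one of `p`.
    obtain ⟨p, hpmax⟩ := (S.filter fun q => weight D q = weight D p₀).exists_maximal
      ⟨p₀, by simp [hp₀]⟩
    obtain ⟨hpS, hpw⟩ := Finset.mem_filter.1 hpmax.1
    have hmin : ∀ q ∈ S, weight D p ≤ weight D q := fun q hq => hpw ▸ hmin₀ q hq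
    have hmax : ∀ q ∈ S, p ≤ q → q = p := fun q hq hpq => by
      refine le_antisymm (hpmax.2 (Finset.mem_filter.2 ⟨hq, ?_⟩) hpq) hpq
      exact hpw ▸ (weight_antitone D hpq).antisymm (hmin q hq)
    rw [← nsum_erase hpS, nadd_comm, nadd_omega0_opow_of_dvd
      (dvd_nsum_opow _ _ fun q hq => hmin q (Finset.mem_of_mem_erase hq))]
    refine ((ih _ (Finset.erase_ssubset hpS)).union_of_separated (hp p) ?_ ?_).mono ?_ le_rfl
    · rintro x hx y ⟨q, hq, hy⟩ hxy
      exact Finset.ne_of_mem_erase hq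
        (hmax q (Finset.mem_of_mem_erase hq) (le_of_mem_piece hx hy hxy))
    · intro h
      obtain ⟨l, hl, hprin⟩ := hb h
      refine ⟨l, β l, isSuccLimit_of_isPrincipal_add (one_lt_omega0.trans_le hl) hprin,
        fun x hx => (hx l).2.trans_le ((D l).add_le _), ?_⟩
      rintro y ⟨q, hq, hy⟩ c hc
      refine ⟨q, hq, fun i => ?_⟩
      by_cases hi : i = l
      · subst hi
        -- Every piece spans the whole indecomposable side `β l`, so raising coordinate `l` does not
        -- leave the piece.
        obtain ⟨h₁, h₂⟩ := (D i).eq_of_isPrincipal (omega0_pos.trans_le hl).ne' hprin (q i)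
        have := (hy i).2
        simp only [h₁, h₂, zero_add] at this
        simpa [h₁, h₂] using hprin hc this
      · simpa [hi] using hy i
    · rintro x (hx | ⟨q, hq, hx⟩)
      exacts [⟨p, hpS, hx⟩, ⟨q, Finset.mem_of_mem_erase hq, hx⟩]

theorem geRank_bad_box_nsum :
    GeRank (SeqRel False) (box 0 β) (nsum Finset.univ fun p => ω ^ weight D p) := by
  refine geRank_box_nsum D (fun p => GeRank.box ?_) False.elim
  simpa [weight] using geRank_box_opow (J := ∅) (b := False) False.elim fun i => (D i).exp (p i)

theorem geRank_antichain_box_nsum (h₁ : ∃ l, ω ≤ β l ∧ IsPrincipal (· + ·) (β l))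
    (h₂ : ∃ j₁ j₂, j₁ ≠ j₂ ∧ ω ^ ω ∣ β j₁ ∧ ω ^ ω ∣ β j₂) :
    GeRank (SeqRel True) (box 0 β) (nsum Finset.univ fun p => ω ^ weight D p) := by
  refine geRank_box_nsum D (fun p => GeRank.box ?_) fun _ => h₁
  obtain ⟨j₁, j₂, hne, hj₁, hj₂⟩ := h₂
  have := geRank_box_opow (J := {j₁, j₂}) (b := True)
    (fun _ => ⟨j₁, by simp, j₂, by simp, hne⟩) fun i => (D i).exp (p i)
  refine (congrArg (fun z => GeRank (SeqRel True) (box 0 z) _) (funext fun i => ?_)).mp this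
  split_ifs with hi
  · have : ω ≤ (D i).exp (p i) := by
      rcases Finset.mem_insert.1 hi with rfl | hi
      · exact ((D i).dvd_iff ω).1 hj₁ _
      · rw [Finset.mem_singleton] at hi
        subst hi
        exact ((D i).dvd_iff ω).1 hj₂ _
    rw [one_add_of_omega0_le this]
  · rfl

/-- Without two factors divisible by `ω ^ ω`, some piece has a smaller width than type. -/
theorem exists_leRank_lt_of_not_dvd {i₀ : ι} (h₀ : ω ≤ β i₀) (h : ∀ i ≠ i₀, ¬ ω ^ ω ∣ β i) :
    ∃ o < nsum Finset.univ fun p => ω ^ weight D p, LeRank (SeqRel True) (box 0 β) o := by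
  -- This selects the deficient piece: a nonzero exponent at `i₀`, finite exponents elsewhere.
  have hp : ∀ i, ∃ k, if i = i₀ then (D i).exp k ≠ 0 else (D i).exp k < ω := by
    intro i
    split_ifs with hi
    · subst hi
      obtain ⟨k, hk⟩ := (D i).exists_le_exp 1 (by simpa using h₀)
      exact ⟨k, Order.one_le_iff_ne_zero.1 hk⟩
    · simpa [(D i).dvd_iff] using h i hi
  choose p hp using hp
  obtain ⟨o, ho, hpo⟩ := exists_leRank_antichain_box_lt (b := True) trivial (i₀ := i₀)
    (e := fun i => (D i).exp (p i)) (by simpa using hp i₀) fun i hi => by simpa [hi] using hp i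
  refine ⟨_, nsum_lt_nsum (f := Function.update (fun p => ω ^ weight D p) p o) (fun q _ => ?_)
    ⟨p, Finset.mem_univ p, by simpa [weight] using ho⟩,
    (LeRank.biUnion fun q _ => ?_).mono (box_subset_pieces D) le_rfl⟩
  · by_cases hq : q = p
    · subst hq; simpa [weight] using ho.le
    · simp [hq]
  · by_cases hq : q = p
    · subst hq; simpa [piece] using hpo.box
    · simpa [hq] using leRank_piece D q

/-- If each factor is finite or decomposable, there are two comparable pieces. -/
theorem exists_leRank_lt_of_not_isPrincipal {i₀ : ι} (h₀ : ¬ IsPrincipal (· + ·) (β i₀))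
    (h : ∀ i, ¬ IsPrincipal (· + ·) (β i) ∨ (β i ≠ 0 ∧ β i < ω)) :
    ∃ o < nsum Finset.univ fun p => ω ^ weight D p, LeRank (SeqRel True) (box 0 β) o := by
  -- In each coordinate, one interval entirely below another. A finite indecomposable factor offers
  -- only one interval, but this is a single point and can be taken twice.
  have hpq : ∀ i, ∃ k k', k ≤ k' ∧ (¬ IsPrincipal (· + ·) (β i) → k < k') ∧
      ∀ x y, x < (D i).lo k + ω ^ (D i).exp k → (D i).lo k' ≤ y → x ≤ y := by
    intro i
    by_cases hi : IsPrincipal (· + ·) (β i)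
    · obtain ⟨hne, hlt⟩ := (h i).resolve_left (not_not.2 hi)
      obtain ⟨k, hk⟩ := (D i).exists_lo_eq_zero hne
      refine ⟨k, k, le_rfl, fun h => absurd hi h, fun x y hx hy => ?_⟩
      have hexp : (D i).exp k = 0 := by
        by_contra hexp
        refine ((D i).add_le k).not_gt (hlt.trans_le (le_trans ?_ le_add_self))
        conv_lhs => rw [← opow_one ω]
        exact opow_le_opow_right omega0_pos (Order.one_le_iff_ne_zero.2 hexp)
      rw [hexp, opow_zero] at hx
      exact (Order.lt_add_one_iff.1 hx).trans hy
    · obtain ⟨k, k', hk⟩ := (D i).exists_lt_of_not_isPrincipal hi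
      exact ⟨k, k', hk.le, fun _ => hk, fun x y hx hy =>
        (hx.le.trans ((D i).separated _ _ hk)).trans hy⟩
  choose p q hle hlt hpq using hpq
  have hne : p ≠ q := fun h => (hlt i₀ h₀).ne (congrFun h i₀)
  have hunion : LeRank (SeqRel True) (piece D p ∪ piece D q) (ω ^ weight D p) := by
    refine (leRank_piece D p).union_of_not_rel ((leRank_piece D q).mono le_rfl
      (opow_le_opow_right omega0_pos (weight_antitone D hle))) fun x hx y hy => ?_
    have hxy : x ≤ y := fun i => hpq i _ _ (hx i).2 (hy i).1
    exact ⟨fun h => h.1 hxy, fun h => h.2 trivial hxy⟩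
  refine ⟨nsum (Finset.univ.erase q) fun p => ω ^ weight D p, ?_,
    -- The index `p` now accounts for both comparable pieces at the cost of one, so the term of `q`
    -- disappears.
    (LeRank.biUnion (C := fun r => if r = p then piece D p ∪ piece D q else piece D r)
      fun r _ => ?_).mono ?_ le_rfl⟩
  · rw [← nsum_erase (Finset.mem_univ q)]
    conv_lhs => rw [← zero_nadd (nsum _ _)]
    exact nadd_lt_nadd_right (opow_pos _ omega0_pos) _
  · split_ifs with hr
    · exact hr ▸ hunion
    · exact leRank_piece D r
  · intro x hx
    obtain ⟨r, -, hr⟩ := box_subset_pieces D hx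
    by_cases hrq : r = q
    · subst hrq
      exact ⟨p, by simp [hne], by simp [hr]⟩
    · refine ⟨r, by simp [hrq], ?_⟩
      split_ifs with hrp
      · exact Or.inl (hrp ▸ hr)
      · exact hr

end

/-! ### Divisibility and exponents in the Cantor normal form -/

theorem forall_mem_CNF_iff_dvd (c o : Ordinal.{u}) :
    (∀ p ∈ CNF ω o, c ≤ p.1) ↔ ω ^ c ∣ o := by
  induction o using WellFoundedLT.induction with
  | _ o ih =>
    rcases eq_or_ne o 0 with rfl | ho
    · simp
    rw [CNF.ne_zero ho, List.forall_mem_cons, ih _ (mod_opow_log_lt_self ω ho)]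
    conv_rhs => rw [← Ordinal.div_add_mod o (ω ^ log ω o)]
    constructor
    · rintro ⟨hc, h⟩
      exact dvd_add ((opow_dvd_opow ω hc).trans (dvd_mul_right _ _)) h
    · intro h
      have hc : c ≤ log ω o := by
        rw [Ordinal.div_add_mod] at h
        exact (opow_le_iff_le_log one_lt_omega0 ho).1 (Ordinal.le_of_dvd ho h)
      exact ⟨hc, (Ordinal.dvd_add_iff ((opow_dvd_opow ω hc).trans (dvd_mul_right _ _))).1 h⟩

theorem hasOnlyInfiniteExponents_iff (α : Ordinal.{u}) :
    HasOnlyInfiniteExponents α ↔ ω ^ ω ∣ α :=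
  forall_mem_CNF_iff_dvd ω α

/-! ### Transfer to the product of ordinals -/

section

variable {n m : ℕ} (α : Fin n → Ordinal.{u}) (k : Fin m → ℕ)

/-- The factors of `OrdinalProduct α k` as ordinals. -/
def factors : Fin n ⊕ Fin m → Ordinal.{u} := Sum.elim α fun j => (k j : Ordinal.{u})

/-- The embedding of `OrdinalProduct α k` into a power of the ordinals. -/
noncomputable def coords (z : OrdinalProduct α k) : Fin n ⊕ Fin m → Ordinal.{u} :=
  Sum.elim (fun i => ((ToType.mk.symm (z.1 i) : Set.Iio (α i)) : Ordinal.{u}))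
    fun j => ((z.2 j : ℕ) : Ordinal.{u})

theorem coords_le_coords {y z : OrdinalProduct α k} : coords α k y ≤ coords α k z ↔ y ≤ z := by
  simp [coords, Pi.le_def, Prod.le_def]

theorem coords_mem_box (z : OrdinalProduct α k) : coords α k z ∈ box 0 (factors α k) := by
  rintro (i | j)
  · exact ⟨zero_le, (zero_add (α i)).symm ▸ (ToType.mk.symm (z.1 i)).2⟩
  · simp [coords, factors]

theorem box_subset_range_coords : box 0 (factors α k) ⊆ Set.range (coords α k) := by
  intro x hx
  have h₁ : ∀ i, x (Sum.inl i) < α i := fun i => by simpa [factors] using (hx (Sum.inl i)).2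
  have h₂ : ∀ j, ∃ a : Fin (k j), x (Sum.inr j) = ((a : ℕ) : Ordinal.{u}) := by
    intro j
    have h : x (Sum.inr j) < k j := by simpa [factors] using (hx (Sum.inr j)).2
    obtain ⟨a, ha⟩ := lt_omega0.1 (h.trans (natCast_lt_omega0 _))
    rw [ha, Nat.cast_lt] at h
    exact ⟨⟨a, h⟩, ha⟩
  choose a ha using h₂
  refine ⟨(fun i => ToType.mk ⟨x (Sum.inl i), h₁ i⟩, a), ?_⟩
  ext (i | j)
  · simp [coords]
  · simp [coords, ha]

variable {α k} {o : Ordinal.{u}}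

theorem seqRel_coords {b : Prop} {y z : OrdinalProduct α k} :
    SeqRel b (coords α k y) (coords α k z) ↔ ¬ y ≤ z ∧ (b → ¬ z ≤ y) := by
  simp only [SeqRel, coords_le_coords]

theorem maxOrderType_le (h : LeRank (SeqRel False) (box 0 (factors α k)) o) :
    maxOrderType (OrdinalProduct α k) ≤ o :=
  haveI : IsWellFounded (seqTree fun x y : OrdinalProduct α k => ¬ x ≤ y) (IsChild _) :=
    badTree_isWellFounded _
  treeRank_le_of_leRank <| h.comap (f := coords α k)
    (fun _ _ _ _ hxy => seqRel_coords.2 ⟨hxy, False.elim⟩) fun z _ => coords_mem_box α k z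

theorem width_le (h : LeRank (SeqRel True) (box 0 (factors α k)) o) :
    width (OrdinalProduct α k) ≤ o :=
  haveI : IsWellFounded (seqTree fun x y : OrdinalProduct α k => ¬ x ≤ y ∧ ¬ y ≤ x) (IsChild _) :=
    incoTree_isWellFounded _
  treeRank_le_of_leRank <| h.comap (f := coords α k)
    (fun _ _ _ _ hxy => seqRel_coords.2 ⟨hxy.1, fun _ => hxy.2⟩) fun z _ => coords_mem_box α k z

theorem le_maxOrderType (h : GeRank (SeqRel False) (box 0 (factors α k)) o) :
    o ≤ maxOrderType (OrdinalProduct α k) :=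
  haveI : IsWellFounded (seqTree fun x y : OrdinalProduct α k => ¬ x ≤ y) (IsChild _) :=
    badTree_isWellFounded _
  le_treeRank_of_geRank <| (h.comap (f := coords α k) (fun _ _ hxy => (seqRel_coords.1 hxy).1)
    (box_subset_range_coords α k)).mono (Set.subset_univ _) le_rfl

theorem le_width (h : GeRank (SeqRel True) (box 0 (factors α k)) o) :
    o ≤ width (OrdinalProduct α k) :=
  haveI : IsWellFounded (seqTree fun x y : OrdinalProduct α k => ¬ x ≤ y ∧ ¬ y ≤ x) (IsChild _) :=
    incoTree_isWellFounded _
  le_treeRank_of_geRank <| (h.comap (f := coords α k)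
    (fun _ _ hxy => ⟨(seqRel_coords.1 hxy).1, (seqRel_coords.1 hxy).2 trivial⟩)
    (box_subset_range_coords α k)).mono (Set.subset_univ _) le_rfl

end

theorem mainTheorem4 {n m : ℕ} (hn : 0 < n) (α : Fin n → Ordinal.{u}) (k : Fin m → ℕ)
    (hα : ∀ i, Ordinal.omega0 ≤ α i) (hk : ∀ j, 0 < k j) :
    (width (OrdinalProduct α k) = maxOrderType (OrdinalProduct α k) ↔
      (∃ i, Ordinal.omega0 ≤ α i ∧ Ordinal.IsPrincipal (· + ·) (α i)) ∧
      ∃ j₁ j₂, j₁ ≠ j₂ ∧ HasOnlyInfiniteExponents (α j₁) ∧ HasOnlyInfiniteExponents (α j₂)) ∧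
    ∀ j, HasOnlyInfiniteExponents (α j) ↔ Ordinal.omega0 ^ Ordinal.omega0 ∣ α j := by
  refine ⟨?_, fun j => hasOnlyInfiniteExponents_iff _⟩
  simp only [hasOnlyInfiniteExponents_iff]
  let D i := (nonempty_omegaSum (factors α k i)).some
  -- Bad sequences always attain the natural sum, so any smaller bound on antichains separates width
  -- from type.
  have hlt : (∃ o < nsum Finset.univ fun p => ω ^ weight D p,
      LeRank (SeqRel True) (box 0 (factors α k)) o) →
      width (OrdinalProduct α k) ≠ maxOrderType (OrdinalProduct α k) := fun ⟨_, ho, h⟩ =>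
    ((width_le h).trans_lt (ho.trans_le (le_maxOrderType (geRank_bad_box_nsum D)))).ne
  constructor
  · intro h
    constructor
    · by_contra! h'
      refine hlt (exists_leRank_lt_of_not_isPrincipal D (i₀ := Sum.inl ⟨0, hn⟩)
        (h' _ (hα _)) ?_) h
      rintro (i | j)
      · exact Or.inl (h' i (hα i))
      · exact Or.inr ⟨by simpa [factors] using (hk j).ne', natCast_lt_omega0 _⟩
    · by_contra! h'
      -- The exceptional index is the only factor divisible by `ω ^ ω`, or an arbitrary one if there
      -- is none.
      obtain ⟨j₀, hj₀⟩ : ∃ j₀, ∀ j ≠ j₀, ¬ ω ^ ω ∣ α j := by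
        by_cases hex : ∃ j₀, ω ^ ω ∣ α j₀
        · obtain ⟨j₀, hj₀⟩ := hex
          exact ⟨j₀, fun j hj => h' j₀ j hj.symm hj₀⟩
        · exact ⟨⟨0, hn⟩, fun j _ hj => hex ⟨j, hj⟩⟩
      refine hlt (exists_leRank_lt_of_not_dvd D (i₀ := Sum.inl j₀) (hα j₀) ?_) h
      rintro (i | j) hi hdvd
      · exact hj₀ i (fun h => hi (h ▸ rfl)) hdvd
      · have h₁ := Ordinal.le_of_dvd (by simpa [factors] using (hk j).ne') hdvd
        have h₂ : ω ≤ ω ^ ω := by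
          conv_lhs => rw [← opow_one ω]
          exact opow_le_opow_right omega0_pos one_lt_omega0.le
        exact (natCast_lt_omega0 (k j)).not_ge (h₂.trans h₁)
  · rintro ⟨⟨i, hi⟩, j₁, j₂, hne, h₁, h₂⟩
    refine ((width_le (leRank_box_nsum D)).trans (le_maxOrderType (geRank_bad_box_nsum D))).antisymm
      ((maxOrderType_le (leRank_box_nsum D)).trans (le_width (geRank_antichain_box_nsum D
        ⟨Sum.inl i, hi⟩ ⟨Sum.inl j₁, Sum.inl j₂, by simpa using hne, h₁, h₂⟩)))
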